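/- Let $A=(a_{ij})\in\mathbb Z^{d\times n}$ have rank $d$ and be homogeneous (its columns lie in a hyperplane of $\mathbb Q^d$ not containing $0$), let $L=\ker_{\mathbb Z}A$, let $B=\{b^{(1)},\dots,b^{(n-d)}\}$ be a basis of $L_{\mathbb C}=\mathbb C\otimes L$ (for instance a basis of $L$), and write $(Bs)_j=\sum_k b^{(k)}_js_k$. Let $\beta\in\mathbb C^d$, let $w\in\mathbb R^n$ be a generic weight (the initial ideal $\mathrm{in}_w(I_A)$ of the toric ideal $I_A$ is monomial), and let $v_0\in\mathbb C^n$ be a fake exponent of $H_A(\beta)$ with respect to $w$, i.e. $Av_0=\beta$ and every monomial of $\mathrm{in}_w(I_A)\subset\mathbb C[\partial_x]$ annihilates $x^{v_0}$. For $v\in\mathbb C^n$ put $\mathrm{nsupp}(v)=\{j: v_j\in\mathbb Z_{<0}\}$; let $\mathrm{NS}=\{\mathrm{nsupp}(v_0+u): u\in L\}$ and let $\mathcal N$ be the set of $I\in\mathrm{NS}$ for which $\min\{w\cdot u: u\in L,\ \mathrm{nsupp}(v_0+u)=I\}$ exists. Let $v\in v_0+L$ be a minimal $w$-weight vector: $\mathrm{nsupp}(v)\in\mathcal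 N$ and $w\cdot(v'-v_0)$ is minimal at $v'=v$ among all $v'\in v_0+L$ with $\mathrm{nsupp}(v')=\mathrm{nsupp}(v)$. Put $I_u=\mathrm{nsupp}(v+u)$ for $u\in L$, let $I_0\in\mathcal N'\subset\mathcal N$, and put $K=\bigcap_{I\in\mathcal N'}I$. For $S\subset\{1,\dots,n\}$ write $t^S=\prod_{j\in S}t_j$ and $(Bs)^S=\prod_{j\in S}(Bs)_j$. Let $m=(Bs)^{I_0\setminus K}$ and $$P=\langle (Bs)^{(I\cup J)\setminus K}: I\in\mathcal N',\ J\in\mathrm{NS}\setminus\mathcal N'\rangle\subset\mathbb C[[s_1,\dots,s_{n-d}]],$$ $$Q(t)=\Big\langle \Big(\sum_j a_{ij}t_j\Big)t^{I\setminus K}: 1\le i\le d,\ I\in\mathcal N'\Big\rangle+\langle t^{(I\cup J)\setminus K}: I\in\mathcal N',\ J\in\mathrm{NS}\setminus\mathcal N'\rangle\subset\mathbb C[[t_1,\dots,t_n]].$$ Let $\Phi:\mathbb C[[t]]\to\mathbb C[[s]]$ be the substitution $t_j\mapsto (Bs)_j$. For an ideal $R$ of $\mathbb C[[t]]$ (resp.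 $\mathbb C[[s]]$) let $R^\perp$ be the set of $q\in\mathbb C[\partial_t]$ (resp. $\mathbb C[\partial_s]$) with $(q\bullet p)|_{0}=0$ for all $p\in R$. Let $a_u(t)=[v+t]_{u_-}/[v+t+u]_{u_+}$, where $u=u_+-u_-$ with $u_\pm\in\mathbb N^n$ of disjoint supports and $[z]_{a}=\prod_j\prod_{k=0}^{a_j-1}(z_j-k)$, and let $$\widetilde F(x,t)=t^{I_0\setminus K}\sum_{u\in L,\ I_u\in\mathcal N'}a_u(t)\,x^{v+t+u},\qquad \widetilde F(x,s)=\widetilde F(x,t)|_{t=Bs}.$$ Then the following two statements are equivalent. 1. Every starting coefficient produced by the extended method is produced by $L$-perturbation: for every $q\in Q(t)^\perp$ there is $q'\in P^\perp$ such that the series $[q(\partial_t)\bullet\widetilde F(x,t)]_{|t=0}$ and $[q'(\partial_s)\bullet\widetilde F(x,s)]_{|s=0}$ have the same coefficient (a polynomial in $\log x_1,\dots,\log x_n$) at $x^v$. 2. $\Phi\big(Q(t):t^{I_0\setminus K}\big)=P:m$. -/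

import Mathlib

/-!
Objects attached to an `A`-hypergeometric system: lattice, toric ideal, fake exponents,
negative supports, the ideals `P` and `Q`, and the (extended) Frobenius series.
-/

noncomputable section

open scoped Classical in
/-- The negative support `{j | v_j is a negative integer}` of a complex vector. -/
def nsupp {n : ℕ} (v : Fin n → ℂ) : Finset (Fin n) :=
  Finset.univ.filter fun j => ∃ k : ℤ, k < 0 ∧ v j = (k : ℂ)

/-- An integer vector, viewed as a complex vector. -/
def toC {n : ℕ} (u : Fin n → ℤ) : Fin n → ℂ := fun j => (u j : ℂ)

/-- `A` is homogeneous: its columns lie in a hyperplane of `ℚ^d` missing the origin. -/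
def IsHomogeneousMatrix {d n : ℕ} (A : Matrix (Fin d) (Fin n) ℤ) : Prop :=
  ∃ c : Fin d → ℚ, ∀ j, ∑ i, c i * (A i j : ℚ) = 1

/-- The lattice `L = Ker_ℤ A`. -/
def latticeL {d n : ℕ} (A : Matrix (Fin d) (Fin n) ℤ) : Submodule ℤ (Fin n → ℤ) :=
  LinearMap.ker A.mulVecLin

/-- `L_ℂ`, the complexification of `L`, as a subspace of `ℂ^n`. -/
def latticeLC {d n : ℕ} (A : Matrix (Fin d) (Fin n) ℤ) : Submodule ℂ (Fin n → ℂ) :=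
  Submodule.span ℂ (toC '' (latticeL A : Set (Fin n → ℤ)))

/-- The pairing `w · u`. -/
def wdot {n : ℕ} (w : Fin n → ℝ) (u : Fin n → ℤ) : ℝ := ∑ j, w j * (u j : ℝ)

/-! ### Toric ideal, generic weights, fake exponents -/

/-- The toric ideal `I_A` in `ℂ[∂_1, …, ∂_n]`. -/
def toricIdeal {d n : ℕ} (A : Matrix (Fin d) (Fin n) ℤ) : Ideal (MvPolynomial (Fin n) ℂ) :=
  Ideal.span {f | ∃ a b : Fin n →₀ ℕ,
    (∀ i, ∑ j, A i j * (a j : ℤ) = ∑ j, A i j * (b j : ℤ)) ∧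
    f = MvPolynomial.monomial a 1 - MvPolynomial.monomial b 1}

open scoped Classical in
/-- The initial form `in_w(f)`: the sum of the terms of `f` of maximal `w`-weight. -/
def initialForm {n : ℕ} (w : Fin n → ℝ) (f : MvPolynomial (Fin n) ℂ) :
    MvPolynomial (Fin n) ℂ :=
  ∑ a ∈ f.support.filter
      (fun a => ∀ b ∈ f.support, ∑ j, w j * (b j : ℝ) ≤ ∑ j, w j * (a j : ℝ)),
    MvPolynomial.monomial a (f.coeff a)

/-- The initial ideal `in_w(I_A)`. -/
def initialIdeal {d n : ℕ} (A : Matrix (Fin d) (Fin n) ℤ) (w : Fin n → ℝ) :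
    Ideal (MvPolynomial (Fin n) ℂ) :=
  Ideal.span (initialForm w '' (toricIdeal A : Set (MvPolynomial (Fin n) ℂ)))

/-- `w` is generic (for `I_A`): `in_w(I_A)` is a monomial ideal. -/
def IsGenericWeight {d n : ℕ} (A : Matrix (Fin d) (Fin n) ℤ) (w : Fin n → ℝ) : Prop :=
  ∃ S : Set (Fin n →₀ ℕ),
    initialIdeal A w = Ideal.span ((fun a => MvPolynomial.monomial a (1 : ℂ)) '' S)

/-- `v` is a fake exponent of `H_A(β)` with respect to `w`: `A v = β`, and every monomial
`∂^a` in `in_w(I_A)` annihilates `x^v`, i.e. `∏_j v_j (v_j - 1) ⋯ (v_j - a_j + 1) = 0`. -/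
def IsFakeExponent {d n : ℕ} (A : Matrix (Fin d) (Fin n) ℤ) (β : Fin d → ℂ) (w : Fin n → ℝ)
    (v : Fin n → ℂ) : Prop :=
  (∀ i, ∑ j, (A i j : ℂ) * v j = β i) ∧
  ∀ a : Fin n →₀ ℕ, MvPolynomial.monomial a (1 : ℂ) ∈ initialIdeal A w →
    ∏ j, ∏ k ∈ Finset.range (a j), (v j - (k : ℂ)) = 0

/-! ### Negative supports -/

/-- `NS = {nsupp(v₀ + u) | u ∈ L}`. -/
def negSupports {d n : ℕ} (A : Matrix (Fin d) (Fin n) ℤ) (v₀ : Fin n → ℂ) :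
    Set (Finset (Fin n)) :=
  {I | ∃ u ∈ latticeL A, nsupp (v₀ + toC u) = I}

/-- `{w · u | u ∈ L, nsupp(v₀ + u) = I}`. -/
def weightsOf {d n : ℕ} (A : Matrix (Fin d) (Fin n) ℤ) (w : Fin n → ℝ) (v₀ : Fin n → ℂ)
    (I : Finset (Fin n)) : Set ℝ :=
  {r | ∃ u ∈ latticeL A, nsupp (v₀ + toC u) = I ∧ r = wdot w u}

/-- `𝒩`: the negative supports `I` for which `min {w · u | u ∈ L, nsupp(v₀ + u) = I}` exists. -/
def boundedNegSupports {d n : ℕ} (A : Matrix (Fin d) (Fin n) ℤ) (w : Fin n → ℝ)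
    (v₀ : Fin n → ℂ) : Set (Finset (Fin n)) :=
  {I | I ∈ negSupports A v₀ ∧ ∃ r, IsLeast (weightsOf A w v₀ I) r}

/-- `v` is a minimal `w`-weight vector: `v ∈ v₀ + L`, `nsupp(v) ∈ 𝒩`, and `w · (v - v₀)` is
minimal among the elements of `v₀ + L` with the same negative support as `v`. -/
def IsMinimalWeightVector {d n : ℕ} (A : Matrix (Fin d) (Fin n) ℤ) (w : Fin n → ℝ)
    (v₀ v : Fin n → ℂ) : Prop :=
  nsupp v ∈ boundedNegSupports A w v₀ ∧
  ∃ u₀ ∈ latticeL A, v = v₀ + toC u₀ ∧ IsLeast (weightsOf A w v₀ (nsupp v)) (wdot w u₀)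

open scoped Classical in
/-- `K_{𝒩'} = ⋂_{I ∈ 𝒩'} I`. -/
def interK {n : ℕ} (N' : Set (Finset (Fin n))) : Finset (Fin n) :=
  Finset.univ.filter fun j => ∀ I ∈ N', j ∈ I

/-! ### Duality between `ℂ[∂]` and power series -/

/-- `(q(∂) • p)|_{0}` for a constant coefficient differential operator `q` and a power series
`p` with coefficients in a `ℂ`-algebra `R`; since `(∂^α • s^γ)|_{s = 0} = δ_{αγ} α!`, it equals
`∑_α q_α α! p_α`. For `R = ℂ` it is the pairing `(q, p)`. -/
def applyAtZero {σ R : Type*} [Fintype σ] [CommRing R] [Algebra ℂ R]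
    (q : MvPolynomial σ ℂ) (p : MvPowerSeries σ R) : R :=
  ∑ α ∈ q.support, (q.coeff α * ∏ i, ((α i).factorial : ℂ)) • MvPowerSeries.coeff α p

/-- `P^⊥` for an ideal `P` of `ℂ[[s]]`. -/
def perp {σ : Type*} [Fintype σ] (P : Ideal (MvPowerSeries σ ℂ)) : Set (MvPolynomial σ ℂ) :=
  {q | ∀ p ∈ P, applyAtZero q p = 0}

/-! ### The two perturbations

A perturbation of the exponent is given by power series `τ_1, …, τ_n`: either `τ_j = t_j`
(all directions) or `τ_j = (B s)_j` (directions in `L`). -/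

/-- The variables `t_j` of `ℂ[[t]]`. -/
def tVar (n : ℕ) (j : Fin n) : MvPowerSeries (Fin n) ℂ := MvPowerSeries.X j

/-- `(B s)_j = ∑_k b^{(k)}_j s_k`. -/
def Bs {n h : ℕ} (b : Fin h → Fin n → ℂ) (j : Fin n) : MvPowerSeries (Fin h) ℂ :=
  ∑ k, MvPowerSeries.C (b k j) * MvPowerSeries.X k

lemma constantCoeff_Bs {n h : ℕ} (b : Fin h → Fin n → ℂ) (j : Fin n) :
    MvPowerSeries.constantCoeff (Bs b j) = 0 := by
  simp [Bs]

lemma hasSubst_Bs {n h : ℕ} (b : Fin h → Fin n → ℂ) : MvPowerSeries.HasSubst (Bs b) :=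
  MvPowerSeries.hasSubst_of_constantCoeff_zero (constantCoeff_Bs b)

/-- `Φ_B : ℂ[[t]] → ℂ[[s]]`, `f ↦ f((B s)_1, …, (B s)_n)`. -/
def Phi {n h : ℕ} (b : Fin h → Fin n → ℂ) :
    MvPowerSeries (Fin n) ℂ →ₐ[ℂ] MvPowerSeries (Fin h) ℂ :=
  MvPowerSeries.substAlgHom (hasSubst_Bs b)

/-- `τ^S = ∏_{j ∈ S} τ_j`. -/
def powSet {n : ℕ} {σ : Type*} (τ : Fin n → MvPowerSeries σ ℂ) (S : Finset (Fin n)) :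
    MvPowerSeries σ ℂ := ∏ j ∈ S, τ j

/-- `⟨τ^{(I ∪ J) \ K_{𝒩'}} | I ∈ 𝒩', J ∈ NS \ 𝒩'⟩`; this is `P_{𝒩'}(t)` for `τ = t`
and `P_{𝒩'}` for `τ = B s`. -/
def idealP {n : ℕ} {σ : Type*} (τ : Fin n → MvPowerSeries σ ℂ)
    (NS N' : Set (Finset (Fin n))) : Ideal (MvPowerSeries σ ℂ) :=
  Ideal.span {f | ∃ I ∈ N', ∃ J ∈ NS \ N', f = powSet τ ((I ∪ J) \ interK N')}

/-- `Q_{𝒩'}(t) = ⟨(A t) t^{I \ K_{𝒩'}} | I ∈ 𝒩'⟩ + P_{𝒩'}(t)`. -/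
def idealQ {d n : ℕ} (A : Matrix (Fin d) (Fin n) ℤ) (NS N' : Set (Finset (Fin n))) :
    Ideal (MvPowerSeries (Fin n) ℂ) :=
  Ideal.span {f | ∃ i : Fin d, ∃ I ∈ N',
      f = (∑ j, MvPowerSeries.C (A i j : ℂ) * tVar n j) * powSet (tVar n) (I \ interK N')}
    ⊔ idealP (tVar n) NS N'

/-- `[v + τ]_{u_-} = ∏_{j : u_j < 0} ∏_{k < -u_j} (v_j + τ_j - k)`. -/
def aNum {n : ℕ} {σ : Type*} (τ : Fin n → MvPowerSeries σ ℂ) (v : Fin n → ℂ)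
    (u : Fin n → ℤ) : MvPowerSeries σ ℂ :=
  ∏ j, ∏ k ∈ Finset.range (-u j).toNat, (MvPowerSeries.C (v j - (k : ℂ)) + τ j)

/-- `[v + τ + u]_{u_+} = ∏_{j : u_j > 0} ∏_{k < u_j} (v_j + τ_j + u_j - k)`. -/
def aDen {n : ℕ} {σ : Type*} (τ : Fin n → MvPowerSeries σ ℂ) (v : Fin n → ℂ)
    (u : Fin n → ℤ) : MvPowerSeries σ ℂ :=
  ∏ j, ∏ k ∈ Finset.range (u j).toNat, (MvPowerSeries.C (v j + (u j : ℂ) - (k : ℂ)) + τ j)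

/-- `a_u = [v + τ]_{u_-} / [v + τ + u]_{u_+}`, in the field of fractions of the power series
ring. -/
def aCoeff {n : ℕ} {σ : Type*} (τ : Fin n → MvPowerSeries σ ℂ) (v : Fin n → ℂ)
    (u : Fin n → ℤ) : FractionRing (MvPowerSeries σ ℂ) :=
  algebraMap _ _ (aNum τ v u) / algebraMap _ _ (aDen τ v u)

/-- The power series `τ^{I_0 \ K_{𝒩'}} a_u`, where `I_0 = nsupp(v)`
(it is a power series when `nsupp(v + u) ∈ 𝒩'`, by `algebraMap_regCoeff` below). -/
def regCoeff {n : ℕ} {σ : Type*} (τ : Fin n → MvPowerSeries σ ℂ) (v : Fin n → ℂ)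
    (N' : Set (Finset (Fin n))) (u : Fin n → ℤ) : MvPowerSeries σ ℂ :=
  Function.invFun (algebraMap (MvPowerSeries σ ℂ) (FractionRing (MvPowerSeries σ ℂ)))
    (algebraMap _ _ (powSet τ (nsupp v \ interK N')) * aCoeff τ v u)

/-- If `nsupp(v + u) ∈ 𝒩'`, then `τ^{I_0 \ K_{𝒩'}} a_u` is a power series, namely
`regCoeff τ v N' u`. -/
lemma algebraMap_regCoeff {n : ℕ} {σ : Type*} (τ : Fin n → MvPowerSeries σ ℂ)
    (hτ : ∀ j, MvPowerSeries.constantCoeff (τ j) = 0) (v : Fin n → ℂ)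
    (N' : Set (Finset (Fin n))) (u : Fin n → ℤ) (hu : nsupp (v + toC u) ∈ N')
    (hne : ∀ j, u j ≠ 0 → τ j ≠ 0) :
    algebraMap _ (FractionRing (MvPowerSeries σ ℂ)) (regCoeff τ v N' u) =
      algebraMap _ _ (powSet τ (nsupp v \ interK N')) * aCoeff τ v u := by
  classical
  have hfac : ∀ (j : Fin n) (c : ℂ), c ≠ 0 → IsUnit (MvPowerSeries.C c + τ j) := by
    intro j c hc
    rw [MvPowerSeries.isUnit_iff_constantCoeff]
    simp [hτ j, hc]
  have hden : aDen τ v u ≠ 0 := by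
    refine Finset.prod_ne_zero_iff.2 fun j _ => Finset.prod_ne_zero_iff.2 fun k hk => ?_
    by_cases hc : v j + (u j : ℂ) - (k : ℂ) = 0
    · rw [hc, map_zero, zero_add]
      refine hne j fun h0 => ?_
      simp [h0] at hk
    · exact (hfac j _ hc).ne_zero
  have hdvd : aDen τ v u ∣ powSet τ (nsupp v \ nsupp (v + toC u)) := by
    have hS : powSet τ (nsupp v \ nsupp (v + toC u)) =
        ∏ j, if j ∈ nsupp v \ nsupp (v + toC u) then τ j else 1 := by
      rw [powSet, Finset.prod_ite_mem, Finset.univ_inter]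
    rw [hS]
    refine Finset.prod_dvd_prod_of_dvd _ _ fun j _ => ?_
    by_cases hex : ∃ k ∈ Finset.range (u j).toNat, v j + (u j : ℂ) - (k : ℂ) = 0
    · obtain ⟨k, hk, hk0⟩ := hex
      have hklt : (k : ℤ) < u j := by
        have := Finset.mem_range.1 hk
        omega
      have hv : v j = (((k : ℤ) - u j : ℤ) : ℂ) := by
        push_cast
        linear_combination hk0
      have hmem : j ∈ nsupp v \ nsupp (v + toC u) := by
        simp only [nsupp, Finset.mem_sdiff, Finset.mem_filter, Finset.mem_univ, true_and]
        refine ⟨⟨(k : ℤ) - u j, by omega, hv⟩, ?_⟩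
        rintro ⟨m, hm, hm'⟩
        have h2 : ((k : ℤ) : ℂ) = (m : ℂ) := by
          rw [← hm', Pi.add_apply, toC, hv]
          push_cast
          ring
        have h3 : (k : ℤ) = m := by exact_mod_cast h2
        omega
      rw [if_pos hmem, ← Finset.mul_prod_erase _ _ hk, hk0, map_zero, zero_add]
      have hun : IsUnit (∏ x ∈ (Finset.range (u j).toNat).erase k,
          (MvPowerSeries.C (v j + (u j : ℂ) - (x : ℂ)) + τ j)) := by
        refine (IsUnit.prod_iff).2 fun x hx => hfac j _ fun h0 => ?_
        refine Finset.ne_of_mem_erase hx ?_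
        have : (x : ℂ) = (k : ℂ) := by linear_combination hk0 - h0
        exact_mod_cast this
      exact hun.mul_right_dvd.2 (dvd_refl _)
    · push Not at hex
      refine IsUnit.dvd ?_
      exact (IsUnit.prod_iff).2 fun k hk => hfac j _ (hex k hk)
  have hsub : nsupp v \ nsupp (v + toC u) ⊆ nsupp v \ interK N' := by
    refine Finset.sdiff_subset_sdiff (Finset.Subset.refl _) fun j hj => ?_
    simp only [interK, Finset.mem_filter, Finset.mem_univ, true_and] at hj
    exact hj _ hu
  obtain ⟨g, hg⟩ : aDen τ v u ∣ powSet τ (nsupp v \ interK N') * aNum τ v u :=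
    (hdvd.trans (Finset.prod_dvd_prod_of_subset _ _ _ hsub)).mul_right _
  refine Function.invFun_eq (f := algebraMap (MvPowerSeries σ ℂ)
    (FractionRing (MvPowerSeries σ ℂ))) ⟨g, ?_⟩
  have hden' : algebraMap (MvPowerSeries σ ℂ) (FractionRing (MvPowerSeries σ ℂ))
      (aDen τ v u) ≠ 0 := by
    simpa using hden
  rw [aCoeff, mul_div_assoc', eq_div_iff hden', ← map_mul, ← map_mul, hg, mul_comm]

lemma tVar_ne_zero (n : ℕ) (j : Fin n) : tVar n j ≠ 0 := by
  intro h
  have := congrArg (MvPowerSeries.coeff (Finsupp.single j 1)) h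
  simp [tVar, MvPowerSeries.coeff_X] at this

lemma Bs_ne_zero {d n : ℕ} (A : Matrix (Fin d) (Fin n) ℤ) {h : ℕ}
    (B : Module.Basis (Fin h) ℂ (latticeLC A)) (u : Fin n → ℤ) (hu : u ∈ latticeL A)
    (j : Fin n) (huj : u j ≠ 0) : Bs (fun k => (B k : Fin n → ℂ)) j ≠ 0 := by
  classical
  intro h0
  have hb : ∀ k, (B k : Fin n → ℂ) j = 0 := by
    intro k
    have := congrArg (MvPowerSeries.coeff (Finsupp.single k 1)) h0
    simpa [Bs, MvPowerSeries.coeff_X, Finsupp.single_left_inj] using this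
  have hmem : toC u ∈ latticeLC A := Submodule.subset_span ⟨u, hu, rfl⟩
  have hx : ∀ x : latticeLC A, (x : Fin n → ℂ) j = 0 := by
    intro x
    rw [← B.sum_repr x]
    simp [hb, -Module.Basis.sum_repr]
  have hj : ((u j : ℤ) : ℂ) = 0 := hx ⟨toC u, hmem⟩
  exact huj (by exact_mod_cast hj)

/-- `exp(∑_i σ_i ℓ_i)` as a power series in the `σ_i`, with coefficients polynomials in
`y = log x`. -/
def expSeries {n : ℕ} {σ : Type*} [Fintype σ] (ℓ : σ → MvPolynomial (Fin n) ℂ) :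
    MvPowerSeries σ (MvPolynomial (Fin n) ℂ) :=
  fun α => (∏ i, ((α i).factorial : ℂ)⁻¹) • ∏ i, ℓ i ^ α i

open scoped Classical in
/-- The series `F̃(x, ·) = τ^{I_0 \ K_{𝒩'}} ∑_{u ∈ L, I_u ∈ 𝒩'} a_u x^{v + τ + u}`.
Its value at `u` is the coefficient of `x^{v+u}`, a power series over `ℂ[y]`, `y = log x`;
`ℓ` is such that `x^τ = exp(∑_j τ_j log x_j) = exp(∑_i σ_i ℓ_i)`. -/
def FTilde {d n : ℕ} {σ : Type*} [Fintype σ] (A : Matrix (Fin d) (Fin n) ℤ)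
    (τ : Fin n → MvPowerSeries σ ℂ) (ℓ : σ → MvPolynomial (Fin n) ℂ) (v : Fin n → ℂ)
    (N' : Set (Finset (Fin n))) (u : Fin n → ℤ) :
    MvPowerSeries σ (MvPolynomial (Fin n) ℂ) :=
  if u ∈ latticeL A ∧ nsupp (v + toC u) ∈ N' then
    MvPowerSeries.map MvPolynomial.C (regCoeff τ v N' u) * expSeries ℓ
  else 0

/-- `F̃_{v,𝒩'}(x, t)`: here `x^t = exp(∑_j t_j y_j)`. -/
def FTildeT {d n : ℕ} (A : Matrix (Fin d) (Fin n) ℤ) (v : Fin n → ℂ)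
    (N' : Set (Finset (Fin n))) :
    (Fin n → ℤ) → MvPowerSeries (Fin n) (MvPolynomial (Fin n) ℂ) :=
  FTilde A (tVar n) MvPolynomial.X v N'

/-- `F̃_{v,𝒩'}(x, s)`: here `x^{B s} = exp(∑_k s_k (b^{(k)} · y))`. -/
def FTildeS {d n h : ℕ} (A : Matrix (Fin d) (Fin n) ℤ) (b : Fin h → Fin n → ℂ)
    (v : Fin n → ℂ) (N' : Set (Finset (Fin n))) :
    (Fin n → ℤ) → MvPowerSeries (Fin h) (MvPolynomial (Fin n) ℂ) :=
  FTilde A (Bs b) (fun k => ∑ j, MvPolynomial.C (b k j) * MvPolynomial.X j) v N'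

/-- The logarithmic series `[q(∂) • F]_{0} = ∑_u r_u(log x) x^{v+u}`, given by
`u ↦ r_u ∈ ℂ[y]`. -/
def frobeniusSeries {n : ℕ} {σ : Type*} [Fintype σ] (q : MvPolynomial σ ℂ)
    (F : (Fin n → ℤ) → MvPowerSeries σ (MvPolynomial (Fin n) ℂ)) :
    (Fin n → ℤ) → MvPolynomial (Fin n) ℂ :=
  fun u => applyAtZero q (F u)

/-- The coefficient (a polynomial in `log x`) of the starting monomial `x^v` in a logarithmic
series `∑_u r_u(log x) x^{v+u}`. -/
def startCoeff {n : ℕ} (φ : (Fin n → ℤ) → MvPolynomial (Fin n) ℂ) : MvPolynomial (Fin n) ℂ :=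
  φ 0


end

/-!
At `u = 0` the coefficient `a_u` is `1`, so the starting coefficient of `[q(∂) • F̃]_{0}` is
`[q(∂) • m exp(t · y)]_{0}`, where `m = t^{I₀ \ K}` and `y = log x`. Its coefficient at `y^γ` is
`(q, m t^γ) / γ!`. Expanding `exp(∑_k s_k (b^{(k)} · y)) = exp(∑_j y_j (B s)_j)` in powers of `y`
shows that in the directions of `L` it is `(q', Φ(m t^γ)) / γ!`. Hence equality of the starting
coefficients for `q` and `q'` means `(q, m f) = (q', Φ(m f))` for all power series `f`
(`startCoeff_eq_iff`, `functional_ext`).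

The inclusion `Φ(Q : m) ⊆ P : Φ(m)` always holds, because `Φ` kills the forms `(A t)_i` and so
maps `Q` into `P`. If the first statement holds and `Φ(f) Φ(m) ∈ P`, then every `q ∈ Q^⊥`
annihilates `f m`. As `Q` has finitely many homogeneous generators, it is closed in the order
topology and equals its double annihilator (`IsFGHomogeneous.mem_of_forall_perp`), so `f ∈ Q : m`.
Since `Φ` is surjective, this is the opposite inclusion (`colon_subset_image_of_forall_perp`).

Conversely, given `q ∈ Q^⊥`, the rule `Φ(m f) ↦ (q, m f)` has to be extended to a functional that
kills `P` and all series of high order; such a functional is the pairing with a polynomial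
(`exists_pairing_eq`). The extension exists as soon as `Φ(m f) ∈ P`, up to high order, implies
`(q, m f) = 0` (`exists_perp_of_colon_subset_image`). By homogeneity a truncation of `Φ(f)` lies in
`P : Φ(m) = Φ(Q : m)`, so `f` is congruent to an element of `Q : m` modulo high order and `⟨A t⟩`,
and `⟨A t⟩ m ⊆ Q` because `I₀ ∈ 𝒩'`. Here `⟨A t⟩` is, up to high order, the kernel of `Φ`: a left
inverse of the matrix of the `b^{(k)}` gives a section `Ψ` of `Φ`, and each `t_j - Ψ(Φ(t_j))`
vanishes on `L_ℂ = ker A`, hence is a combination of the rows of `A`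
(`exists_leftInverse_basis`, `sub_Phi_Phi_mem`).
-/

open MvPowerSeries

/-! ### The filtration of a power series ring by order -/

/-- The ideal of power series of order at least `N`. -/
def orderIdeal (σ : Type*) (N : ℕ) : Ideal (MvPowerSeries σ ℂ) where
  carrier := {f | (N : ℕ∞) ≤ f.order}
  add_mem' ha hb := (le_min ha hb).trans min_order_le_add
  zero_mem' := by simp
  smul_mem' c f hf := le_trans (le_add_left hf) le_order_mul

lemma mem_orderIdeal {σ : Type*} {N : ℕ} {f : MvPowerSeries σ ℂ} :
    f ∈ orderIdeal σ N ↔ (N : ℕ∞) ≤ f.order := Iff.rfl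

lemma mem_orderIdeal_iff_coeff {σ : Type*} {N : ℕ} {f : MvPowerSeries σ ℂ} :
    f ∈ orderIdeal σ N ↔ ∀ α : σ →₀ ℕ, α.degree < N → coeff α f = 0 :=
  ⟨fun h _ hα => coeff_of_lt_order (lt_of_lt_of_le (by exact_mod_cast hα) h), nat_le_order⟩

lemma orderIdeal_anti {σ : Type*} {N M : ℕ} (h : N ≤ M) : orderIdeal σ M ≤ orderIdeal σ N :=
  fun _ hf => le_trans (by exact_mod_cast h) (mem_orderIdeal.1 hf)

lemma sub_truncTotal_mem_orderIdeal {σ : Type*} [Finite σ] (N : ℕ) (f : MvPowerSeries σ ℂ) :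
    f - (truncTotal N f : MvPolynomial σ ℂ) ∈ orderIdeal σ N := by
  rw [mem_orderIdeal_iff_coeff]
  intro α hα
  simp [coeff_truncTotal_eq_ite, hα]

/-- Substituting series without constant term does not lower the order. -/
lemma subst_mem_orderIdeal {σ τ : Type*} {a : σ → MvPowerSeries τ ℂ} (ha : HasSubst a)
    (h0 : ∀ i, constantCoeff (a i) = 0) {N : ℕ} {f : MvPowerSeries σ ℂ}
    (hf : f ∈ orderIdeal σ N) : subst a f ∈ orderIdeal τ N := by
  refine le_trans (le_trans ?_ (mul_le_mul' (le_iInf fun i =>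
    one_le_order_iff_constCoeff_eq_zero.2 (h0 i)) (le_refl f.order))) (le_order_subst ha f)
  simpa using! hf

/-- Multiplication by a homogeneous series commutes with truncation, up to a shift. -/
lemma truncTotal_mul_of_isHomogeneous {σ : Type*} [Finite σ] {g : MvPowerSeries σ ℂ} {e : ℕ}
    (hg : g.IsHomogeneous e) (N : ℕ) (c : MvPowerSeries σ ℂ) :
    ((truncTotal N (c * g) : MvPolynomial σ ℂ) : MvPowerSeries σ ℂ) =
      (truncTotal (N - e) c : MvPolynomial σ ℂ) * g := by
  classical
  ext α
  have hite : (if α.degree < N then coeff α (c * g) else 0) =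
      ∑ x ∈ Finset.HasAntidiagonal.antidiagonal α,
        if α.degree < N then coeff x.1 c * coeff x.2 g else 0 := by
    split_ifs <;> simp [coeff_mul]
  rw [MvPolynomial.coeff_coe, coeff_truncTotal_eq_ite, hite, coeff_mul]
  refine Finset.sum_congr rfl fun x hx => ?_
  by_cases hx2 : x.2.degree = e
  · have hdeg : x.1.degree + x.2.degree = α.degree := by
      rw [← map_add, Finset.HasAntidiagonal.mem_antidiagonal.1 hx]
    have : α.degree < N ↔ x.1.degree < N - e := by omega
    simp only [MvPolynomial.coeff_coe, coeff_truncTotal_eq_ite, this]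
    split_ifs <;> simp
  · simp [hg.coeff_eq_zero hx2]

/-! ### Ideals generated by homogeneous power series -/

/-- The ideal is generated by finitely many homogeneous power series. -/
def IsFGHomogeneous {σ : Type*} (I : Ideal (MvPowerSeries σ ℂ)) : Prop :=
  ∃ S : Set (MvPowerSeries σ ℂ), S.Finite ∧ (∀ g ∈ S, ∃ e, g.IsHomogeneous e) ∧ Ideal.span S = I

lemma IsFGHomogeneous.exists_fun.{u} {σ : Type u} {I : Ideal (MvPowerSeries σ ℂ)}
    (hI : IsFGHomogeneous I) : ∃ (ι : Type u) (_ : Fintype ι) (g : ι → MvPowerSeries σ ℂ)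
      (e : ι → ℕ), (∀ i, (g i).IsHomogeneous (e i)) ∧ (∀ i, g i ∈ I) ∧
      ∀ f ∈ I, ∃ c : ι → MvPowerSeries σ ℂ, ∑ i, c i * g i = f := by
  obtain ⟨S, hS, hhom, rfl⟩ := hI
  choose e he using fun g : S => hhom g g.2
  let := hS.fintype
  refine ⟨S, hS.fintype, Subtype.val, e, he, fun i => Ideal.subset_span i.2, fun f hf => ?_⟩
  rw [← Subtype.range_coe (s := S), Ideal.span, Submodule.mem_span_range_iff_exists_fun] at hf
  simpa only [smul_eq_mul] using hf

lemma IsFGHomogeneous.sup {σ : Type*} {I J : Ideal (MvPowerSeries σ ℂ)}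
    (hI : IsFGHomogeneous I) (hJ : IsFGHomogeneous J) : IsFGHomogeneous (I ⊔ J) := by
  obtain ⟨S, hS, hSh, rfl⟩ := hI
  obtain ⟨T, hT, hTh, rfl⟩ := hJ
  exact ⟨S ∪ T, hS.union hT, fun g hg => hg.elim (hSh g) (hTh g), Ideal.span_union S T⟩

/-- An ideal with homogeneous generators is stable under truncation. -/
lemma IsFGHomogeneous.truncTotal_mem {σ : Type*} [Finite σ] {I : Ideal (MvPowerSeries σ ℂ)}
    (hI : IsFGHomogeneous I) {N : ℕ} {f : MvPowerSeries σ ℂ} (hf : f ∈ I ⊔ orderIdeal σ N) :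
    ((truncTotal N f : MvPolynomial σ ℂ) : MvPowerSeries σ ℂ) ∈ I := by
  obtain ⟨ι, _, g, e, he, hg, hspan⟩ := hI.exists_fun
  obtain ⟨a, ha, r, hr, rfl⟩ := Submodule.mem_sup.1 hf
  have hr0 : truncTotal N r = 0 := by
    ext α
    rw [coeff_truncTotal_eq_ite]
    split_ifs with h
    · simpa using mem_orderIdeal_iff_coeff.1 hr α h
    · simp
  obtain ⟨c, rfl⟩ := hspan a ha
  rw [map_add, hr0, add_zero, map_sum, ← MvPolynomial.coeToMvPowerSeries.ringHom_apply, map_sum]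
  refine Ideal.sum_mem _ fun i _ => ?_
  rw [MvPolynomial.coeToMvPowerSeries.ringHom_apply, truncTotal_mul_of_isHomogeneous (he i)]
  exact I.mul_mem_left _ (hg i)

/-- An ideal with finitely many homogeneous generators is closed in the order topology. -/
lemma IsFGHomogeneous.mem_of_forall_mem_sup {σ : Type*} {I : Ideal (MvPowerSeries σ ℂ)}
    (hI : IsFGHomogeneous I) {f : MvPowerSeries σ ℂ} (hf : ∀ N, f ∈ I ⊔ orderIdeal σ N) :
    f ∈ I := by
  classical
  obtain ⟨ι, _, g, e, he, hg, hspan⟩ := hI.exists_fun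
  have key : ∀ k, ∃ c : ι → MvPowerSeries σ ℂ, ∀ α : σ →₀ ℕ, α.degree = k →
      coeff α f = coeff α (∑ i, c i * g i) := by
    intro k
    obtain ⟨a, ha, r, hr, rfl⟩ := Submodule.mem_sup.1 (hf (k + 1))
    obtain ⟨c, rfl⟩ := hspan a ha
    refine ⟨c, fun α hα => ?_⟩
    rw [map_add, mem_orderIdeal_iff_coeff.1 hr α (by omega), add_zero]
  choose c hc using key
  -- The degree `k` part of the coefficient of `g i` is read off from degree `k + e i` of `f`.
  let C' : ι → MvPowerSeries σ ℂ := fun i α => coeff α (c (α.degree + e i) i)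
  have hC' : ∀ i α, coeff α (C' i) = coeff α (c (α.degree + e i) i) := fun _ _ => rfl
  have : f = ∑ i, C' i * g i := by
    ext α
    rw [hc _ α rfl, map_sum, map_sum]
    refine Finset.sum_congr rfl fun i _ => ?_
    rw [coeff_mul, coeff_mul]
    refine Finset.sum_congr rfl fun x hx => ?_
    by_cases hx2 : x.2.degree = e i
    · rw [hC', ← hx2, ← map_add, Finset.HasAntidiagonal.mem_antidiagonal.1 hx]
    · simp [IsHomogeneous.coeff_eq_zero (he i) hx2]
  rw [this]
  exact Ideal.sum_mem _ fun i _ => I.mul_mem_left _ (hg i)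

/-! ### Duality between polynomials and power series -/

/-- The pairing with a fixed operator `q`, as a linear functional on power series. -/
def pairing {σ : Type*} [Fintype σ] (q : MvPolynomial σ ℂ) : MvPowerSeries σ ℂ →ₗ[ℂ] ℂ where
  toFun := applyAtZero q
  map_add' f g := by simp [applyAtZero, mul_add, Finset.sum_add_distrib]
  map_smul' c f := by
    simp only [applyAtZero, smul_eq_mul, map_smul, Finset.mul_sum, RingHom.id_apply]
    exact Finset.sum_congr rfl fun _ _ => by ring

@[simp] lemma pairing_apply {σ : Type*} [Fintype σ] (q : MvPolynomial σ ℂ)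
    (f : MvPowerSeries σ ℂ) : pairing q f = applyAtZero q f := rfl

lemma exists_pairing_eq_zero {σ : Type*} [Fintype σ] (q : MvPolynomial σ ℂ) :
    ∃ N, ∀ f ∈ orderIdeal σ N, pairing q f = 0 := by
  refine ⟨q.totalDegree + 1, fun f hf => Finset.sum_eq_zero fun α hα => ?_⟩
  have h : α.degree ≤ q.totalDegree := MvPolynomial.le_totalDegree hα
  rw [mem_orderIdeal_iff_coeff.1 hf α (by omega), smul_zero]

/-- Linear functionals that vanish in high order are determined by their values on monomials. -/
lemma functional_ext {σ : Type*} [Finite σ] {V : Type*} [AddCommGroup V] [Module ℂ V]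
    {φ ψ : MvPowerSeries σ ℂ →ₗ[ℂ] V}
    {N : ℕ} (hφ : ∀ f ∈ orderIdeal σ N, φ f = 0) (hψ : ∀ f ∈ orderIdeal σ N, ψ f = 0)
    (h : ∀ α, φ (monomial α 1) = ψ (monomial α 1)) (f : MvPowerSeries σ ℂ) : φ f = ψ f := by
  have hpol : ∀ p : MvPolynomial σ ℂ, φ p = ψ p := by
    intro p
    induction p using MvPolynomial.induction_on' with
    | monomial α a =>
      have : ((MvPolynomial.monomial α a : MvPolynomial σ ℂ) : MvPowerSeries σ ℂ) =
          a • monomial α (1 : ℂ) := by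
        rw [MvPolynomial.coe_monomial, ← map_smul, smul_eq_mul, mul_one]
      rw [this, map_smul, map_smul, h]
    | add p q hp hq => rw [MvPolynomial.coe_add, map_add, map_add, hp, hq]
  have hr := sub_truncTotal_mem_orderIdeal N f
  rw [← sub_add_cancel f (truncTotal N f : MvPolynomial σ ℂ), map_add, map_add, hφ _ hr, hψ _ hr,
    hpol]

/-- A linear functional that vanishes in high order is the pairing with some operator. -/
lemma exists_pairing_eq {σ : Type*} [Fintype σ] (φ : MvPowerSeries σ ℂ →ₗ[ℂ] ℂ) {N : ℕ}
    (hφ : ∀ f ∈ orderIdeal σ N, φ f = 0) : ∃ q, pairing q = φ := by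
  classical
  have hfact : ∀ α : σ →₀ ℕ, (∏ i, ((α i).factorial : ℂ)) ≠ 0 := fun α =>
    Finset.prod_ne_zero_iff.2 fun i _ => by exact_mod_cast (α i).factorial_ne_zero
  have hmon : ∀ α : σ →₀ ℕ, N ≤ α.degree → φ (monomial α 1) = 0 := fun α hα => by
    refine hφ _ (mem_orderIdeal_iff_coeff.2 fun β hβ => ?_)
    rw [coeff_monomial_ne]
    rintro rfl
    omega
  let q : MvPolynomial σ ℂ := ∑ α ∈ (Finsupp.finite_of_degree_lt (σ := σ) N).toFinset,
    MvPolynomial.monomial α (φ (monomial α 1) / ∏ i, ((α i).factorial : ℂ))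
  have hq : ∀ α, q.coeff α = φ (monomial α 1) / ∏ i, ((α i).factorial : ℂ) := by
    intro α
    simp only [q, MvPolynomial.coeff_sum, MvPolynomial.coeff_monomial, Finset.sum_ite_eq',
      Set.Finite.mem_toFinset, Set.mem_ofPred_eq, ite_eq_left_iff, not_lt]
    intro h
    rw [hmon α h, zero_div]
  refine ⟨q, LinearMap.ext fun f => ?_⟩
  obtain ⟨M, hM⟩ := exists_pairing_eq_zero q
  refine functional_ext (N := max N M) (fun f hf => hM f (orderIdeal_anti (le_max_right _ _) hf))
    (fun f hf => hφ f (orderIdeal_anti (le_max_left _ _) hf)) (fun α => ?_) f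
  rw [pairing_apply, applyAtZero, Finset.sum_eq_single α]
  · rw [coeff_monomial_same, hq, div_mul_cancel₀ _ (hfact α), smul_eq_mul, mul_one]
  · intro β _ hβ
    rw [coeff_monomial_ne hβ, smul_zero]
  · intro hα
    rw [MvPolynomial.notMem_support_iff.1 hα, zero_mul, zero_smul]

/-- The double annihilator of an ideal with finitely many homogeneous generators is the ideal. -/
lemma IsFGHomogeneous.mem_of_forall_perp {σ : Type*} [Fintype σ] {I : Ideal (MvPowerSeries σ ℂ)}
    (hI : IsFGHomogeneous I) {f : MvPowerSeries σ ℂ} (hf : ∀ q ∈ perp I, applyAtZero q f = 0) :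
    f ∈ I := by
  refine hI.mem_of_forall_mem_sup fun N => ?_
  by_contra hfN
  obtain ⟨φ, hφf, hφ⟩ := Submodule.exists_le_ker_of_notMem
    (p := (I ⊔ orderIdeal σ N).restrictScalars ℂ) (v := f) hfN
  obtain ⟨q, rfl⟩ := exists_pairing_eq φ (N := N) fun g hg =>
    hφ (show g ∈ I ⊔ orderIdeal σ N from Ideal.mem_sup_right hg)
  exact hφf (hf q fun p hp => hφ (show p ∈ I ⊔ orderIdeal σ N from Ideal.mem_sup_left hp))

/-! ### Transfer of colon ideals along a surjection with a section -/

section Transfer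

variable {σ τ : Type*} [Fintype σ] [Fintype τ]
  {Φ : MvPowerSeries σ ℂ →ₐ[ℂ] MvPowerSeries τ ℂ} {Ψ : MvPowerSeries τ ℂ → MvPowerSeries σ ℂ}
  {Q Z : Ideal (MvPowerSeries σ ℂ)} {P : Ideal (MvPowerSeries τ ℂ)} {m : MvPowerSeries σ ℂ}

lemma colon_subset_image_of_forall_perp (hΦord : ∀ N, ∀ f ∈ orderIdeal σ N, Φ f ∈ orderIdeal τ N)
    (hsurj : ∀ p, Φ (Ψ p) = p) (hQ : IsFGHomogeneous Q)
    (h : ∀ q ∈ perp Q, ∃ q' ∈ perp P, ∀ γ,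
      applyAtZero q (m * monomial γ 1) = applyAtZero q' (Φ (m * monomial γ 1))) :
    (P.colon {Φ m} : Set (MvPowerSeries τ ℂ)) ⊆ Φ '' (Q.colon {m} : Set (MvPowerSeries σ ℂ)) := by
  intro p hp
  rw [SetLike.mem_coe, Submodule.mem_colon_singleton, smul_eq_mul] at hp
  refine ⟨Ψ p, ?_, hsurj p⟩
  rw [SetLike.mem_coe, Submodule.mem_colon_singleton, smul_eq_mul]
  refine hQ.mem_of_forall_perp fun q hq => ?_
  obtain ⟨q', hq', hqq'⟩ := h q hq
  obtain ⟨N, hN⟩ := exists_pairing_eq_zero q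
  obtain ⟨N', hN'⟩ := exists_pairing_eq_zero q'
  have key := functional_ext (N := max N N') (φ := pairing q ∘ₗ LinearMap.mulLeft ℂ m)
    (ψ := pairing q' ∘ₗ Φ.toLinearMap ∘ₗ LinearMap.mulLeft ℂ m)
    (fun f hf => hN _ (Ideal.mul_mem_left _ _ (orderIdeal_anti (le_max_left _ _) hf)))
    (fun f hf => hN' _ (hΦord _ _ (Ideal.mul_mem_left _ _
      (orderIdeal_anti (le_max_right _ _) hf)))) hqq' (Ψ p)
  simp only [LinearMap.comp_apply, LinearMap.mulLeft_apply, pairing_apply,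
    AlgHom.toLinearMap_apply, map_mul, hsurj] at key
  rw [mul_comm, key]
  exact hq' _ (by rwa [mul_comm])

/-- The functional `m Φ(f) ↦ (q, m f)` is well defined modulo `P` and high order, hence it extends
to a functional on the target that kills `P`. -/
lemma exists_perp_of_colon_subset_image
    (hΨord : ∀ N, ∀ f ∈ orderIdeal τ N, Ψ f ∈ orderIdeal σ N)
    (hsec : ∀ N f, f - Ψ (Φ f) ∈ Z ⊔ orderIdeal σ N) (hZ : ∀ f ∈ Z, f * m ∈ Q)
    (hP : IsFGHomogeneous P) {e : ℕ} (hm : (Φ m).IsHomogeneous e)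
    (h : (P.colon {Φ m} : Set (MvPowerSeries τ ℂ)) ⊆
      Φ '' (Q.colon {m} : Set (MvPowerSeries σ ℂ)))
    {q : MvPolynomial σ ℂ} (hq : q ∈ perp Q) :
    ∃ q' ∈ perp P, ∀ f, applyAtZero q (m * f) = applyAtZero q' (Φ (m * f)) := by
  obtain ⟨N, hN⟩ := exists_pairing_eq_zero q
  let J := P ⊔ orderIdeal τ (N + e)
  let T : MvPowerSeries σ ℂ →ₗ[ℂ] MvPowerSeries τ ℂ ⧸ J :=
    (Ideal.Quotient.mkₐ ℂ J).toLinearMap ∘ₗ Φ.toLinearMap ∘ₗ LinearMap.mulLeft ℂ m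
  have hT : ∀ f, T f = Ideal.Quotient.mk J (Φ (m * f)) := fun _ => rfl
  have hker : pairing q ∘ₗ LinearMap.mulLeft ℂ m ∈ (LinearMap.ker T).dualAnnihilator := by
    rw [Submodule.mem_dualAnnihilator]
    intro f hf
    rw [LinearMap.mem_ker, hT, Ideal.Quotient.eq_zero_iff_mem, map_mul, mul_comm] at hf
    have htr := hP.truncTotal_mem hf
    rw [truncTotal_mul_of_isHomogeneous hm, Nat.add_sub_cancel] at htr
    obtain ⟨f', hf', hff'⟩ := h (show ((truncTotal N (Φ f) : MvPolynomial τ ℂ) :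
        MvPowerSeries τ ℂ) ∈ P.colon {Φ m} by
      rwa [Submodule.mem_colon_singleton, smul_eq_mul])
    rw [SetLike.mem_coe, Submodule.mem_colon_singleton, smul_eq_mul] at hf'
    have hord : Ψ (Φ (f - f')) ∈ orderIdeal σ N := by
      refine hΨord _ _ ?_
      rw [map_sub, hff']
      exact sub_truncTotal_mem_orderIdeal N _
    have hdiff : f - f' ∈ Z ⊔ orderIdeal σ N := by
      rw [← sub_add_cancel (f - f') (Ψ (Φ (f - f')))]
      exact add_mem (hsec N _) (Ideal.mem_sup_right hord)
    obtain ⟨z, hz, r, hr, hzr⟩ := Submodule.mem_sup.1 hdiff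
    have hf_eq : m * f = f' * m + z * m + m * r := by linear_combination -m * hzr
    rw [LinearMap.comp_apply, LinearMap.mulLeft_apply, hf_eq, map_add, map_add,
      hN _ (Ideal.mul_mem_left _ _ hr), pairing_apply, pairing_apply, hq _ hf', hq _ (hZ z hz),
      add_zero, add_zero]
  rw [← LinearMap.range_dualMap_eq_dualAnnihilator_ker] at hker
  obtain ⟨ψ, hψ⟩ := hker
  obtain ⟨q', hq'⟩ := exists_pairing_eq (N := N + e)
    (ψ ∘ₗ (Ideal.Quotient.mkₐ ℂ J).toLinearMap) fun f hf => by
      have : Ideal.Quotient.mk J f = 0 :=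
        Ideal.Quotient.eq_zero_iff_mem.2 (Ideal.mem_sup_right hf)
      simp [this]
  refine ⟨q', fun p hp => ?_, fun f => ?_⟩
  · have : Ideal.Quotient.mk J p = 0 := Ideal.Quotient.eq_zero_iff_mem.2 (Ideal.mem_sup_left hp)
    rw [← pairing_apply, hq']
    simp [this]
  · rw [← pairing_apply q', hq']
    exact (LinearMap.congr_fun hψ f).symm

end Transfer

/-! ### Linear forms -/

lemma isHomogeneous_Bs {n h : ℕ} (b : Fin h → Fin n → ℂ) (j : Fin n) :
    (Bs b j).IsHomogeneous 1 := by
  intro α hα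
  by_contra hne
  refine hα ?_
  rw [Bs, map_sum]
  refine Finset.sum_eq_zero fun k _ => ?_
  rw [coeff_C_mul, coeff_X, if_neg, mul_zero]
  rintro rfl
  exact hne (by simp [Finsupp.weight_single])

/-- The variables `t_j` are the linear forms attached to the identity matrix. -/
lemma Bs_one (n : ℕ) : Bs (fun k j : Fin n => (1 : Matrix (Fin n) (Fin n) ℂ) k j) = tVar n := by
  funext j
  simp [Bs, tVar, Matrix.one_apply, apply_ite (C (σ := Fin n) (R := ℂ))]

lemma isHomogeneous_tVar (n : ℕ) (j : Fin n) : (tVar n j).IsHomogeneous 1 := by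
  rw [← Bs_one]
  exact isHomogeneous_Bs _ j

lemma isHomogeneous_powSet {n : ℕ} {σ : Type*} {τ : Fin n → MvPowerSeries σ ℂ}
    (hτ : ∀ j, (τ j).IsHomogeneous 1) (S : Finset (Fin n)) :
    (powSet τ S).IsHomogeneous S.card := by
  classical
  induction S using Finset.induction_on with
  | empty =>
    intro α hα
    rw [powSet, Finset.prod_empty, coeff_one] at hα
    have : α = 0 := by by_contra h; simp [h] at hα
    simp [this]
  | insert j S hj ih =>
    rw [powSet, Finset.prod_insert hj, Finset.card_insert_of_notMem hj, add_comm]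
    exact IsHomogeneous.mul (hτ j) ih

lemma isFGHomogeneous_idealP {n : ℕ} {σ : Type*} {τ : Fin n → MvPowerSeries σ ℂ}
    (hτ : ∀ j, (τ j).IsHomogeneous 1) (NS N' : Set (Finset (Fin n))) :
    IsFGHomogeneous (idealP τ NS N') := by
  refine ⟨_, (Set.finite_range (powSet τ)).subset ?_, ?_, rfl⟩
  · rintro f ⟨I, _, J, _, rfl⟩
    exact ⟨_, rfl⟩
  · rintro f ⟨I, _, J, _, rfl⟩
    exact ⟨_, isHomogeneous_powSet hτ _⟩

/-- The linear forms `(A t)_i`. -/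
noncomputable def rowForm {d n : ℕ} (A : Matrix (Fin d) (Fin n) ℤ) (i : Fin d) :
    MvPowerSeries (Fin n) ℂ :=
  ∑ j, C (A i j : ℂ) * tVar n j

lemma isHomogeneous_rowForm {d n : ℕ} (A : Matrix (Fin d) (Fin n) ℤ) (i : Fin d) :
    (rowForm A i).IsHomogeneous 1 :=
  isHomogeneous_Bs (fun j i => (A i j : ℂ)) i

lemma isFGHomogeneous_idealQ {d n : ℕ} (A : Matrix (Fin d) (Fin n) ℤ)
    (NS N' : Set (Finset (Fin n))) : IsFGHomogeneous (idealQ A NS N') := by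
  refine IsFGHomogeneous.sup ⟨_, (Set.finite_range fun x : Fin d × Finset (Fin n) =>
    rowForm A x.1 * powSet (tVar n) x.2).subset ?_, ?_, rfl⟩
    (isFGHomogeneous_idealP (isHomogeneous_tVar n) NS N')
  · rintro f ⟨i, I, _, rfl⟩
    exact ⟨(i, _), rfl⟩
  · rintro f ⟨i, I, _, rfl⟩
    exact ⟨_, IsHomogeneous.mul (isHomogeneous_rowForm A i)
      (isHomogeneous_powSet (isHomogeneous_tVar n) _)⟩

/-! ### Linear substitutions -/

lemma Phi_X {n h : ℕ} (b : Fin h → Fin n → ℂ) (j : Fin n) : Phi b (X j) = Bs b j :=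
  substAlgHom_X _ _

lemma Phi_C {n h : ℕ} (b : Fin h → Fin n → ℂ) (c : ℂ) : Phi b (C c) = C c :=
  (Phi b).commutes c

lemma Phi_mem_orderIdeal {n h : ℕ} (b : Fin h → Fin n → ℂ) {N : ℕ}
    {f : MvPowerSeries (Fin n) ℂ} (hf : f ∈ orderIdeal (Fin n) N) :
    Phi b f ∈ orderIdeal (Fin h) N := by
  rw [Phi, substAlgHom_apply]
  exact subst_mem_orderIdeal (hasSubst_Bs b) (constantCoeff_Bs b) hf

lemma Phi_powSet {n h : ℕ} (b : Fin h → Fin n → ℂ) (S : Finset (Fin n)) :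
    Phi b (powSet (tVar n) S) = powSet (Bs b) S := by
  simp only [powSet, tVar, map_prod, Phi_X]

lemma Phi_monomial {n h : ℕ} (b : Fin h → Fin n → ℂ) (γ : Fin n →₀ ℕ) :
    Phi b (monomial γ 1) = ∏ j, Bs b j ^ γ j := by
  rw [Phi, substAlgHom_monomial, map_one, one_mul, Finsupp.prod_fintype _ _ fun _ => pow_zero _]

lemma Phi_one {n : ℕ} (f : MvPowerSeries (Fin n) ℂ) :
    Phi (fun k j : Fin n => (1 : Matrix (Fin n) (Fin n) ℂ) k j) f = f := by
  rw [Phi, substAlgHom_apply, Bs_one]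
  exact congrFun subst_self f

/-- Composing linear substitutions multiplies their matrices. -/
lemma Phi_Bs {n h m : ℕ} (b : Fin h → Fin n → ℂ) (c : Fin n → Fin m → ℂ) (k : Fin m) :
    Phi b (Bs c k) = Bs (fun l k => ∑ j, b l j * c j k) k := by
  simp only [Bs, map_sum, map_mul, Phi_C, Phi_X, Finset.mul_sum, Finset.sum_mul]
  rw [Finset.sum_comm]
  refine Finset.sum_congr rfl fun l _ => Finset.sum_congr rfl fun j _ => ?_
  ring

lemma Phi_Phi_of_mul_eq_one {n h : ℕ} {b : Fin h → Fin n → ℂ} {c : Fin n → Fin h → ℂ}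
    (hbc : ∀ l k, ∑ j, b l j * c j k = (1 : Matrix (Fin h) (Fin h) ℂ) l k)
    (p : MvPowerSeries (Fin h) ℂ) : Phi b (Phi c p) = p := by
  have : (fun k => subst (Bs b) (Bs c k)) = (X : Fin h → MvPowerSeries (Fin h) ℂ) := by
    funext k
    have := Phi_Bs b c k
    rw [Phi, substAlgHom_apply] at this
    simp only [this, hbc]
    exact congrFun (Bs_one h) k
  rw [Phi, Phi, substAlgHom_apply, substAlgHom_apply,
    subst_comp_subst_apply (hasSubst_Bs c) (hasSubst_Bs b), this]
  exact congrFun subst_self p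

/-- If `t_j ≡ Ψ(Φ(t_j))` modulo an ideal, then `f ≡ Ψ(Φ(f))` modulo that ideal and high order. -/
lemma sub_Phi_Phi_mem {n h : ℕ} (b : Fin h → Fin n → ℂ) (c : Fin n → Fin h → ℂ)
    {Z : Ideal (MvPowerSeries (Fin n) ℂ)} (hZ : ∀ j, tVar n j - Phi c (Bs b j) ∈ Z) (N : ℕ)
    (f : MvPowerSeries (Fin n) ℂ) : f - Phi c (Phi b f) ∈ Z ⊔ orderIdeal (Fin n) N := by
  have hpol : ∀ p : MvPolynomial (Fin n) ℂ,
      (p : MvPowerSeries (Fin n) ℂ) - Phi c (Phi b p) ∈ Z := by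
    intro p
    rw [← Ideal.Quotient.mk_eq_mk_iff_sub_mem]
    have : (Ideal.Quotient.mkₐ ℂ Z).comp (MvPolynomial.coeToMvPowerSeries.algHom ℂ) =
        (Ideal.Quotient.mkₐ ℂ Z).comp (((Phi c).comp (Phi b)).comp
          (MvPolynomial.coeToMvPowerSeries.algHom ℂ)) := by
      refine MvPolynomial.algHom_ext fun j => ?_
      have := (Ideal.Quotient.mk_eq_mk_iff_sub_mem _ _).2 (hZ j)
      simpa [Phi_X, tVar] using this
    simpa using AlgHom.congr_fun this p
  have hr := sub_truncTotal_mem_orderIdeal N f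
  have hsplit : f - Phi c (Phi b f) =
      ((truncTotal N f : MvPolynomial (Fin n) ℂ) - Phi c (Phi b (truncTotal N f :
        MvPolynomial (Fin n) ℂ))) + ((f - (truncTotal N f : MvPolynomial (Fin n) ℂ)) -
        Phi c (Phi b (f - (truncTotal N f : MvPolynomial (Fin n) ℂ)))) := by
    rw [map_sub, map_sub]
    ring
  rw [hsplit]
  exact add_mem (Ideal.mem_sup_left (hpol _)) (Ideal.mem_sup_right
    (sub_mem hr (Phi_mem_orderIdeal _ (Phi_mem_orderIdeal _ hr))))

/-! ### The kernel of `A` over the complex numbers -/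

lemma mulVec_eq_zero_of_mem_latticeLC {d n : ℕ} {A : Matrix (Fin d) (Fin n) ℤ} {x : Fin n → ℂ}
    (hx : x ∈ latticeLC A) : (A.map (Int.cast : ℤ → ℂ)).mulVec x = 0 := by
  refine (Submodule.span_le (p := LinearMap.ker (A.map (Int.cast : ℤ → ℂ)).mulVecLin)).2 ?_ hx
  rintro _ ⟨u, hu, rfl⟩
  have hu' : A.mulVec u = 0 := hu
  ext i
  have := congrArg (Int.cast : ℤ → ℂ) (congrFun hu' i)
  simpa [Matrix.mulVec, dotProduct, toC] using this

/-- Rank is unchanged by extending scalars, so `A` stays surjective over `ℂ`. -/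
lemma mulVec_surjective_of_rank_eq {d n : ℕ} {A : Matrix (Fin d) (Fin n) ℤ}
    (hrank : (A.map (Int.cast : ℤ → ℚ)).rank = d) :
    Function.Surjective (A.map (Int.cast : ℤ → ℂ)).mulVec := by
  have hsurj : Function.Surjective (A.map (Int.cast : ℤ → ℚ)).mulVec := by
    have : LinearMap.range (A.map (Int.cast : ℤ → ℚ)).mulVecLin = ⊤ :=
      Submodule.eq_top_of_finrank_eq (by simpa [Matrix.rank] using hrank)
    exact LinearMap.range_eq_top.1 this
  obtain ⟨R, hR⟩ := Matrix.mulVec_surjective_iff_exists_right_inverse.1 hsurj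
  refine Matrix.mulVec_surjective_iff_exists_right_inverse.2
    ⟨R.map (algebraMap ℚ ℂ), ?_⟩
  have hmap : A.map (Int.cast : ℤ → ℂ) = (A.map (Int.cast : ℤ → ℚ)).map (algebraMap ℚ ℂ) := by
    ext i j
    simp
  rw [hmap, ← Matrix.map_mul, hR, Matrix.map_one _ (map_zero _) (map_one _)]

lemma mem_latticeLC_iff {d n : ℕ} {A : Matrix (Fin d) (Fin n) ℤ}
    (hrank : (A.map (Int.cast : ℤ → ℚ)).rank = d)
    (B : Module.Basis (Fin (n - d)) ℂ (latticeLC A)) {x : Fin n → ℂ} :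
    x ∈ latticeLC A ↔ (A.map (Int.cast : ℤ → ℂ)).mulVec x = 0 := by
  have hle : latticeLC A ≤ LinearMap.ker (A.map (Int.cast : ℤ → ℂ)).mulVecLin :=
    fun x hx => mulVec_eq_zero_of_mem_latticeLC hx
  have hfin := LinearMap.finrank_range_add_finrank_ker (A.map (Int.cast : ℤ → ℂ)).mulVecLin
  rw [LinearMap.range_eq_top.2 (mulVec_surjective_of_rank_eq hrank), finrank_top] at hfin
  have heq := Submodule.eq_of_le_of_finrank_eq hle (by
    rw [Module.finrank_eq_card_basis B]
    simp only [Module.finrank_fin_fun, Fintype.card_fin] at hfin ⊢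
    omega)
  rw [heq]
  rfl

/-- A left inverse `c` of the matrix `b` of a basis of `L_ℂ`; each `t_j - (b c t)_j` vanishes on
`L_ℂ`, so it is a combination of the rows of `A`. -/
lemma exists_leftInverse_basis {d n : ℕ} {A : Matrix (Fin d) (Fin n) ℤ}
    (hrank : (A.map (Int.cast : ℤ → ℚ)).rank = d)
    (B : Module.Basis (Fin (n - d)) ℂ (latticeLC A)) :
    ∃ (c : Fin n → Fin (n - d) → ℂ) (ρ : Fin n → Fin d → ℂ),
      (∀ l k, ∑ j, (B l : Fin n → ℂ) j * c j k =
        (1 : Matrix (Fin (n - d)) (Fin (n - d)) ℂ) l k) ∧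
      ∀ j j', (1 : Matrix (Fin n) (Fin n) ℂ) j' j - ∑ k, c j' k * (B k : Fin n → ℂ) j =
        ∑ i, ρ j i * (A i j' : ℂ) := by
  obtain ⟨p, hp⟩ := LinearMap.exists_leftInverse_of_injective (latticeLC A).subtype
    (Submodule.ker_subtype _)
  have hp' : ∀ x : latticeLC A, p x = x := fun x => LinearMap.congr_fun hp x
  have hsingle : ∀ x : Fin n → ℂ, ∑ j, x j • (Pi.single j 1 : Fin n → ℂ) = x := fun x => by
    ext i
    simp [Finset.sum_apply, Pi.single_apply]
  let c : Fin n → Fin (n - d) → ℂ := fun j k => B.repr (p (Pi.single j 1)) k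
  have hc : ∀ (x : Fin n → ℂ) k, ∑ j, x j * c j k = B.repr (p x) k := by
    intro x k
    conv_rhs => rw [← hsingle x]
    simp [c]
  -- The functional `x ↦ x_j - (p x)_j` vanishes on the kernel of `A`.
  have hdual : ∀ j, ∃ ψ : Module.Dual ℂ (Fin d → ℂ), ∀ x : Fin n → ℂ,
      ψ ((A.map (Int.cast : ℤ → ℂ)).mulVec x) = x j - (p x : Fin n → ℂ) j := by
    intro j
    let φ : Module.Dual ℂ (Fin n → ℂ) :=
      LinearMap.proj j - LinearMap.proj j ∘ₗ (latticeLC A).subtype ∘ₗ p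
    have hφ : φ ∈ (LinearMap.ker (A.map (Int.cast : ℤ → ℂ)).mulVecLin).dualAnnihilator := by
      rw [Submodule.mem_dualAnnihilator]
      intro x hx
      have hxL : x ∈ latticeLC A := (mem_latticeLC_iff hrank B).2 hx
      simp [φ, hp' ⟨x, hxL⟩]
    rw [← LinearMap.range_dualMap_eq_dualAnnihilator_ker] at hφ
    obtain ⟨ψ, hψ⟩ := hφ
    exact ⟨ψ, fun x => LinearMap.congr_fun hψ x⟩
  choose ψ hψ using hdual
  refine ⟨c, fun j i => ψ j (Pi.single i 1), fun l k => ?_, fun j j' => ?_⟩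
  · rw [hc, hp', B.repr_self, Finsupp.single_apply, Matrix.one_apply]
  · have h1 := hψ j (Pi.single j' 1)
    have h2 : (p (Pi.single j' 1) : Fin n → ℂ) j = ∑ k, c j' k * (B k : Fin n → ℂ) j := by
      conv_lhs => rw [← B.sum_repr (p (Pi.single j' 1))]
      simp [c, -Module.Basis.sum_repr]
    have h3 : ψ j ((A.map (Int.cast : ℤ → ℂ)).mulVec (Pi.single j' 1)) =
        ∑ i, ψ j (Pi.single i 1) * (A i j' : ℂ) := by
      have : (A.map (Int.cast : ℤ → ℂ)).mulVec (Pi.single j' 1) =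
          ∑ i, (A i j' : ℂ) • (Pi.single i 1 : Fin d → ℂ) := by
        ext i
        simp [Finset.sum_apply, Pi.single_apply]
      rw [this, map_sum]
      exact Finset.sum_congr rfl fun i _ => by rw [map_smul, smul_eq_mul, mul_comm]
    rw [← h3, h1, h2, Matrix.one_apply, Pi.single_apply]
    simp only [eq_comm]

/-! ### Starting coefficients -/

lemma regCoeff_zero {n : ℕ} {σ : Type*} (τ : Fin n → MvPowerSeries σ ℂ) (v : Fin n → ℂ)
    (N' : Set (Finset (Fin n))) : regCoeff τ v N' 0 = powSet τ (nsupp v \ interK N') := by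
  rw [regCoeff]
  have h : aCoeff τ v 0 = 1 := by simp [aCoeff, aNum, aDen]
  rw [h, mul_one]
  exact Function.leftInverse_invFun (IsFractionRing.injective _ _) _

lemma startCoeff_FTilde {d n : ℕ} {σ : Type*} [Fintype σ] (A : Matrix (Fin d) (Fin n) ℤ)
    (τ : Fin n → MvPowerSeries σ ℂ) (ℓ : σ → MvPolynomial (Fin n) ℂ) {v : Fin n → ℂ}
    {N' : Set (Finset (Fin n))} (hv : nsupp v ∈ N') (q : MvPolynomial σ ℂ) :
    startCoeff (frobeniusSeries q (FTilde A τ ℓ v N')) =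
      applyAtZero q (map MvPolynomial.C (powSet τ (nsupp v \ interK N')) * expSeries ℓ) := by
  have h0 : v + toC (0 : Fin n → ℤ) = v := by
    ext j
    simp [toC]
  rw [startCoeff, frobeniusSeries, FTilde, if_pos ⟨zero_mem _, by rwa [h0]⟩, regCoeff_zero]

/-- The multinomial theorem for a power of a linear form `∑ ℓ_k s_k`, coefficient by
coefficient. -/
lemma coeff_sum_C_mul_X_pow {ι R : Type*} [Fintype ι] [CommRing R] (ℓ : ι → R) (N : ℕ)
    (α : ι →₀ ℕ) :
    coeff α ((∑ k, C (ℓ k) * X k : MvPowerSeries ι R) ^ N) =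
      if α.degree = N then Nat.multinomial Finset.univ α • ∏ k, ℓ k ^ α k else 0 := by
  classical
  have hterm : ∀ κ : ι → ℕ, ∏ k, (C (ℓ k) * X k : MvPowerSeries ι R) ^ κ k =
      C (∏ k, ℓ k ^ κ k) * monomial (Finsupp.equivFunOnFinite.symm κ) 1 := by
    intro κ
    rw [monomial_one_eq, Finsupp.prod_fintype _ _ fun _ => pow_zero _, map_prod,
      ← Finset.prod_mul_distrib]
    exact Finset.prod_congr rfl fun k _ => by simp [mul_pow]
  simp only [Finset.sum_pow_eq_sum_piAntidiag, map_sum, ← nsmul_eq_mul, map_nsmul, hterm,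
    coeff_C_mul, coeff_monomial]
  have hiff : ∀ κ : ι → ℕ, α = Finsupp.equivFunOnFinite.symm κ ↔ κ = α := fun κ => by
    rw [← Equiv.symm_apply_eq, Equiv.symm_symm, eq_comm]
    rfl
  simp only [hiff, mul_ite, mul_one, mul_zero, smul_ite, smul_zero, Finset.sum_ite_eq',
    Finset.mem_piAntidiag]
  refine if_congr ?_ rfl rfl
  simp [Finsupp.degree_eq_sum]

/-- Both sides come from expanding `(∑_{k,j} b^{(k)}_j s_k y_j)^N` by the multinomial theorem,
once along the `s_k` and once along the `y_j`. -/
lemma multinomial_coeff_prod_pow {n h : ℕ} (b : Fin h → Fin n → ℂ) (N : ℕ) (α : Fin h →₀ ℕ)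
    (γ : Fin n →₀ ℕ) :
    (if α.degree = N then Nat.multinomial Finset.univ α • MvPolynomial.coeff γ
      (∏ k, (∑ j, MvPolynomial.C (b k j) * MvPolynomial.X j) ^ α k) else 0) =
    if γ.degree = N then Nat.multinomial Finset.univ γ • coeff α (∏ j, Bs b j ^ γ j) else 0 := by
  classical
  have hswap : (∑ k, C (∑ j, MvPolynomial.C (b k j) * MvPolynomial.X j) * X k :
      MvPowerSeries (Fin h) (MvPolynomial (Fin n) ℂ)) =
      ∑ j, C (MvPolynomial.X j) * map MvPolynomial.C (Bs b j) := by
    simp only [Bs, map_sum, map_mul, map_C, map_X, Finset.mul_sum, Finset.sum_mul]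
    rw [Finset.sum_comm]
    exact Finset.sum_congr rfl fun j _ => Finset.sum_congr rfl fun k _ => by ring
  have hterm : ∀ κ : Fin n → ℕ, ∏ j, (C (MvPolynomial.X j) * map MvPolynomial.C (Bs b j) :
      MvPowerSeries (Fin h) (MvPolynomial (Fin n) ℂ)) ^ κ j =
      C (MvPolynomial.monomial (Finsupp.equivFunOnFinite.symm κ) 1) *
        map MvPolynomial.C (∏ j, Bs b j ^ κ j) := by
    intro κ
    rw [MvPolynomial.monomial_eq, MvPolynomial.C_1, one_mul,
      Finsupp.prod_fintype _ _ fun _ => pow_zero _, map_prod, map_prod,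
      ← Finset.prod_mul_distrib]
    exact Finset.prod_congr rfl fun k _ => by simp [mul_pow]
  have hcoeff := congrArg (MvPolynomial.coeff γ)
    (coeff_sum_C_mul_X_pow (fun k => ∑ j, MvPolynomial.C (b k j) * MvPolynomial.X j) N α)
  rw [apply_ite (MvPolynomial.coeff γ), MvPolynomial.coeff_zero, MvPolynomial.coeff_smul]
    at hcoeff
  rw [← hcoeff, hswap]
  have hiff : ∀ κ : Fin n → ℕ, Finsupp.equivFunOnFinite.symm κ = γ ↔ κ = γ := fun κ => by
    rw [Equiv.symm_apply_eq]
    rfl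
  simp only [Finset.sum_pow_eq_sum_piAntidiag, map_sum, ← nsmul_eq_mul, map_nsmul, hterm,
    coeff_C_mul, coeff_map, MvPolynomial.coeff_sum, MvPolynomial.coeff_smul,
    mul_comm (MvPolynomial.monomial _ _) (MvPolynomial.C _),
    MvPolynomial.coeff_C_mul, MvPolynomial.coeff_monomial, hiff, mul_ite, mul_one, mul_zero,
    smul_ite, smul_zero, Finset.sum_ite_eq', Finset.mem_piAntidiag]
  refine if_congr ?_ rfl rfl
  simp [Finsupp.degree_eq_sum]

/-- The expansion of `exp(∑_k s_k (b^{(k)} · y)) = exp(∑_j y_j (B s)_j)` in powers of `y`. -/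
lemma coeff_expSeries {n h : ℕ} (b : Fin h → Fin n → ℂ) (α : Fin h →₀ ℕ) (γ : Fin n →₀ ℕ) :
    MvPolynomial.coeff γ (coeff α (expSeries fun k =>
      ∑ j, MvPolynomial.C (b k j) * MvPolynomial.X j)) =
    (∏ j, ((γ j).factorial : ℂ))⁻¹ * coeff α (Phi b (monomial γ 1)) := by
  have hmult : ∀ {m : ℕ} (κ : Fin m →₀ ℕ), (κ.degree.factorial : ℂ) =
      (∏ i, ((κ i).factorial : ℂ)) * Nat.multinomial Finset.univ κ := by
    intro m κ
    rw [Finsupp.degree_eq_sum]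
    exact_mod_cast (Nat.multinomial_spec Finset.univ κ).symm
  have hfact : ∀ {m : ℕ} (κ : Fin m →₀ ℕ), (∏ i, ((κ i).factorial : ℂ)) ≠ 0 := fun κ =>
    Finset.prod_ne_zero_iff.2 fun i _ => by exact_mod_cast (κ i).factorial_ne_zero
  have hne : ∀ {m : ℕ} (κ : Fin m →₀ ℕ), (Nat.multinomial Finset.univ κ : ℂ) ≠ 0 := fun κ => by
    exact_mod_cast (Nat.multinomial_pos _ _).ne'
  rw [Phi_monomial]
  change MvPolynomial.coeff γ ((∏ i, ((α i).factorial : ℂ)⁻¹) • ∏ k, (∑ j,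
    MvPolynomial.C (b k j) * MvPolynomial.X j) ^ α k) = _
  rw [MvPolynomial.coeff_smul, smul_eq_mul, Finset.prod_inv_distrib]
  have h1 := multinomial_coeff_prod_pow b α.degree α γ
  rw [if_pos rfl] at h1
  by_cases hdeg : γ.degree = α.degree
  · rw [if_pos hdeg, nsmul_eq_mul, nsmul_eq_mul] at h1
    have hα := hmult α
    rw [← hdeg, hmult γ] at hα
    rw [inv_mul_eq_div, inv_mul_eq_div, div_eq_div_iff (hfact α) (hfact γ)]
    refine mul_left_cancel₀ (hne α) ?_
    linear_combination (∏ i, ((γ i).factorial : ℂ)) * h1 + coeff α (∏ j, Bs b j ^ γ j) * hα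
  · have h2 := multinomial_coeff_prod_pow b γ.degree α γ
    rw [if_neg (Ne.symm hdeg), if_pos rfl, nsmul_eq_mul, eq_comm] at h2
    rw [if_neg hdeg, nsmul_eq_mul] at h1
    rw [(mul_eq_zero.1 h1).resolve_left (hne α), (mul_eq_zero.1 h2).resolve_left (hne γ),
      mul_zero, mul_zero]

lemma coeff_applyAtZero_map_mul_expSeries {n h : ℕ} (b : Fin h → Fin n → ℂ)
    (q : MvPolynomial (Fin h) ℂ) (p : MvPowerSeries (Fin h) ℂ) (γ : Fin n →₀ ℕ) :
    MvPolynomial.coeff γ (applyAtZero q (map MvPolynomial.C p * expSeries fun k =>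
      ∑ j, MvPolynomial.C (b k j) * MvPolynomial.X j)) =
    (∏ j, ((γ j).factorial : ℂ))⁻¹ * applyAtZero q (p * Phi b (monomial γ 1)) := by
  classical
  simp only [applyAtZero, MvPolynomial.coeff_sum, MvPolynomial.coeff_smul, Finset.mul_sum,
    coeff_mul, coeff_map, MvPolynomial.coeff_C_mul, coeff_expSeries, smul_eq_mul]
  refine Finset.sum_congr rfl fun α _ => Finset.sum_congr rfl fun x _ => ?_
  ring

lemma startCoeff_FTildeS_coeff {d n h : ℕ} (A : Matrix (Fin d) (Fin n) ℤ)
    (b : Fin h → Fin n → ℂ) {v : Fin n → ℂ} {N' : Set (Finset (Fin n))} (hv : nsupp v ∈ N')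
    (q : MvPolynomial (Fin h) ℂ) (γ : Fin n →₀ ℕ) :
    MvPolynomial.coeff γ (startCoeff (frobeniusSeries q (FTildeS A b v N'))) =
      (∏ j, ((γ j).factorial : ℂ))⁻¹ * applyAtZero q
        (Phi b (powSet (tVar n) (nsupp v \ interK N') * monomial γ 1)) := by
  rw [FTildeS, startCoeff_FTilde A _ _ hv, coeff_applyAtZero_map_mul_expSeries, map_mul,
    Phi_powSet]

/-- Perturbing in all directions is the case of the identity matrix. -/
lemma FTildeT_eq_FTildeS_one {d n : ℕ} (A : Matrix (Fin d) (Fin n) ℤ) (v : Fin n → ℂ)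
    (N' : Set (Finset (Fin n))) : FTildeT A v N' =
      FTildeS A (fun k j : Fin n => (1 : Matrix (Fin n) (Fin n) ℂ) k j) v N' := by
  classical
  rw [FTildeT, FTildeS, Bs_one]
  congr 1
  funext k
  simp [Matrix.one_apply, apply_ite (MvPolynomial.C (σ := Fin n) (R := ℂ))]

/-- The starting coefficients for `q` and `q'` agree exactly when the functionals
`(q, t^{I₀ \ K} ·)` and `(q', Φ(t^{I₀ \ K} ·))` agree on monomials. -/
lemma startCoeff_eq_iff {d n h : ℕ} (A : Matrix (Fin d) (Fin n) ℤ) (b : Fin h → Fin n → ℂ)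
    {v : Fin n → ℂ} {N' : Set (Finset (Fin n))} (hv : nsupp v ∈ N')
    (q : MvPolynomial (Fin n) ℂ) (q' : MvPolynomial (Fin h) ℂ) :
    startCoeff (frobeniusSeries q (FTildeT A v N')) =
      startCoeff (frobeniusSeries q' (FTildeS A b v N')) ↔
    ∀ γ, applyAtZero q (powSet (tVar n) (nsupp v \ interK N') * monomial γ 1) =
      applyAtZero q' (Phi b (powSet (tVar n) (nsupp v \ interK N') * monomial γ 1)) := by
  rw [MvPolynomial.ext_iff]
  refine forall_congr' fun γ => ?_
  rw [FTildeT_eq_FTildeS_one, startCoeff_FTildeS_coeff A _ hv, startCoeff_FTildeS_coeff A _ hv,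
    Phi_one]
  refine mul_right_inj' (inv_ne_zero (Finset.prod_ne_zero_iff.2 fun i _ => ?_))
  exact_mod_cast (γ i).factorial_ne_zero

/-! ### Comparison of the two perturbations -/

/-- `Φ` kills the forms `(A t)_i` and maps the monomial generators of `Q` to those of `P`. -/
lemma Phi_mem_idealP_of_mem_idealQ {d n h : ℕ} {A : Matrix (Fin d) (Fin n) ℤ}
    (b : Fin h → latticeLC A) (NS N' : Set (Finset (Fin n))) {f : MvPowerSeries (Fin n) ℂ}
    (hf : f ∈ idealQ A NS N') :
    Phi (fun k => (b k : Fin n → ℂ)) f ∈ idealP (Bs fun k => (b k : Fin n → ℂ)) NS N' := by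
  suffices h : idealQ A NS N' ≤
      (idealP (Bs fun k => (b k : Fin n → ℂ)) NS N').comap (Phi fun k => (b k : Fin n → ℂ)) from
    h hf
  refine sup_le (Ideal.span_le.2 ?_) (Ideal.span_le.2 ?_)
  · rintro _ ⟨i, I, _, rfl⟩
    have hrow : Phi (fun k => (b k : Fin n → ℂ)) (∑ j, C (A i j : ℂ) * tVar n j) = 0 := by
      refine (Phi_Bs (fun k => (b k : Fin n → ℂ)) (fun j i => (A i j : ℂ)) i).trans ?_
      refine Finset.sum_eq_zero fun k _ => ?_
      have := congrFun (mulVec_eq_zero_of_mem_latticeLC (b k).2) i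
      simp only [Matrix.mulVec, dotProduct, Matrix.map_apply, Pi.zero_apply] at this
      simp only [mul_comm _ (A i _ : ℂ), this, map_zero, zero_mul]
    rw [SetLike.mem_coe, Ideal.mem_comap, map_mul, hrow, zero_mul]
    exact zero_mem _
  · rintro _ ⟨I, hI, J, hJ, rfl⟩
    rw [SetLike.mem_coe, Ideal.mem_comap, Phi_powSet]
    exact Ideal.subset_span ⟨I, hI, J, hJ, rfl⟩

/-- The row relations `ρ` write `t_j - Ψ(Φ(t_j))` as a combination of the forms `(A t)_i`. -/
lemma tVar_sub_Phi_Bs_mem {d n h : ℕ} {A : Matrix (Fin d) (Fin n) ℤ} (b : Fin h → Fin n → ℂ)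
    (c : Fin n → Fin h → ℂ) {ρ : Fin n → Fin d → ℂ}
    (hρ : ∀ j j', (1 : Matrix (Fin n) (Fin n) ℂ) j' j - ∑ k, c j' k * b k j =
      ∑ i, ρ j i * (A i j' : ℂ)) (j : Fin n) :
    tVar n j - Phi c (Bs b j) ∈ Ideal.span (Set.range (rowForm A)) := by
  have : tVar n j - Phi c (Bs b j) = ∑ i, C (ρ j i) * rowForm A i := by
    rw [Phi_Bs, ← Bs_one]
    simp only [Bs, rowForm, tVar, Finset.mul_sum]
    rw [Finset.sum_comm, ← Finset.sum_sub_distrib]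
    refine Finset.sum_congr rfl fun j' _ => ?_
    rw [← sub_mul, ← map_sub, hρ, map_sum, Finset.sum_mul]
    simp only [map_mul, mul_assoc]
  rw [this]
  exact Ideal.sum_mem _ fun i _ => Ideal.mul_mem_left _ _ (Ideal.subset_span ⟨i, rfl⟩)

theorem mainTheorem7 {d n : ℕ} (A : Matrix (Fin d) (Fin n) ℤ)
    (hrank : (A.map (Int.cast : ℤ → ℚ)).rank = d) (hA : IsHomogeneousMatrix A)
    (β : Fin d → ℂ) (w : Fin n → ℝ) (hw : IsGenericWeight A w)
    (v₀ : Fin n → ℂ) (hv₀ : IsFakeExponent A β w v₀)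
    (v : Fin n → ℂ) (hv : IsMinimalWeightVector A w v₀ v)
    (B : Module.Basis (Fin (n - d)) ℂ (latticeLC A))
    (N' : Set (Finset (Fin n))) (hN' : N' ⊆ boundedNegSupports A w v₀) (hI₀ : nsupp v ∈ N') :
    (∀ q ∈ perp (idealQ A (negSupports A v₀) N'),
      ∃ q' ∈ perp (idealP (Bs fun k => (B k : Fin n → ℂ)) (negSupports A v₀) N'),
        startCoeff (frobeniusSeries q (FTildeT A v N')) =
          startCoeff (frobeniusSeries q' (FTildeS A (fun k => (B k : Fin n → ℂ)) v N'))) ↔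
    (Phi fun k => (B k : Fin n → ℂ)) ''
        ((idealQ A (negSupports A v₀) N').colon {powSet (tVar n) (nsupp v \ interK N')} :
          Set (MvPowerSeries (Fin n) ℂ)) =
      ((idealP (Bs fun k => (B k : Fin n → ℂ)) (negSupports A v₀) N').colon
          {powSet (Bs fun k => (B k : Fin n → ℂ)) (nsupp v \ interK N')} :
        Set (MvPowerSeries (Fin (n - d)) ℂ)) := by
  set b : Fin (n - d) → Fin n → ℂ := fun k => (B k : Fin n → ℂ)
  obtain ⟨c, ρ, hbc, hρ⟩ := exists_leftInverse_basis hrank B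
  have hQ := isFGHomogeneous_idealQ A (negSupports A v₀) N'
  have hP := isFGHomogeneous_idealP (isHomogeneous_Bs b) (negSupports A v₀) N'
  have hm : (Phi b (powSet (tVar n) (nsupp v \ interK N'))).IsHomogeneous
      (nsupp v \ interK N').card := by
    rw [Phi_powSet]
    exact isHomogeneous_powSet (isHomogeneous_Bs b) _
  have hZ : ∀ f ∈ Ideal.span (Set.range (rowForm A)),
      f * powSet (tVar n) (nsupp v \ interK N') ∈ idealQ A (negSupports A v₀) N' := by
    have : Ideal.span (Set.range (rowForm A)) ≤ (idealQ A (negSupports A v₀) N').colon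
        {powSet (tVar n) (nsupp v \ interK N')} := by
      rw [Ideal.span_le]
      rintro _ ⟨i, rfl⟩
      rw [SetLike.mem_coe, Submodule.mem_colon_singleton]
      exact Ideal.mem_sup_left (Ideal.subset_span ⟨i, _, hI₀, rfl⟩)
    exact fun f hf => Submodule.mem_colon_singleton.1 (this hf)
  -- This inclusion always holds, so only the opposite one is at stake.
  have hsub : Phi b '' ((idealQ A (negSupports A v₀) N').colon
      {powSet (tVar n) (nsupp v \ interK N')} : Set (MvPowerSeries (Fin n) ℂ)) ⊆
      ((idealP (Bs b) (negSupports A v₀) N').colon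
        {Phi b (powSet (tVar n) (nsupp v \ interK N'))} :
        Set (MvPowerSeries (Fin (n - d)) ℂ)) := by
    rintro _ ⟨f, hf, rfl⟩
    rw [SetLike.mem_coe, Submodule.mem_colon_singleton, smul_eq_mul] at hf ⊢
    rw [← map_mul]
    exact Phi_mem_idealP_of_mem_idealQ (fun k => B k) _ _ hf
  simp only [startCoeff_eq_iff A b hI₀]
  rw [← Phi_powSet b]
  refine ⟨fun h => hsub.antisymm ?_, fun h q hq => ?_⟩
  · exact colon_subset_image_of_forall_perp (Ψ := Phi c)
      (fun N f hf => Phi_mem_orderIdeal b hf) (Phi_Phi_of_mul_eq_one hbc) hQ h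
  · obtain ⟨q', hq', hqq'⟩ := exists_perp_of_colon_subset_image (Ψ := Phi c)
      (fun N f hf => Phi_mem_orderIdeal c hf)
      (fun N f => sub_Phi_Phi_mem b c (tVar_sub_Phi_Bs_mem b c hρ) N f) hZ hP hm h.symm.subset hq
    exact ⟨q', hq', fun γ => hqq' _⟩
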